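/- \textbf{Setting.} A repeated game with private monitoring and public communication has players $N=\{1,\dots,n\}$ and, for each player $i$, finite sets $A_i$ of actions, $S_i$ of private signals and $M_i$ of public messages; $A=\prod_i A_i$, $S=\prod_i S_i$, $M=\prod_i M_i$. Stage payoffs are $g:A\to\mathbb R^n$, and for each $a\in A$, $p(\cdot\mid a)$ is a probability distribution on $S$ whose marginal on each $S_i$ has full support. Let $R=\prod_i R_i$, where $R_i$ is the set of message strategies $\rho_i:S_i\to M_i$. A pair $(a,\rho)\in A\times R$ induces the distribution $\tilde p(m\mid (a,\rho))=\sum_{s:\ \rho_i(s_i)=m_i\ \forall i}p(s\mid a)$ on $M$; $E[\,\cdot\mid (a,\rho)]$ is the expectation under it. For $x:M\to\mathbb R^n$, a deviation $(a_i',\rho_i')\in A_i\times R_i$ of player $i$ from $(a,\rho)$ is \emph{nontrivial with respect to $x$} if $a_i'\neq a_i$ or the distribution of the vector $x(m)$ under $\tilde p(\cdot\mid (a_i',\rho_i'),(a_{-i},\rho_{-i}))$ differs from the one under $\tilde p(\cdot\mid(a,\rho))$. Fix $\eta\ge 0$. \textbf{Equilibrium payoffs.} A pure public strategy of player $i$ chooses,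 after each finite public history $h$ (the list of past message profiles), an action in $A_i$ and, given $h$ and the own action, a message strategy in $R_i$. For a profile $\sigma$ of such strategies let $\sigma(h)=(\sigma^a(h),\sigma^m(h,\sigma^a(h)))\in A\times R$ denote the play at $h$, and for $\delta\in(0,1)$ let $w^\sigma(h)\in\mathbb R^n$ be the profile of expected discounted average continuation payoffs at $h$, i.e. the expectation of $(1-\delta)\sum_{t\ge 0}\delta^{t}g(\tilde a^{t})$, where $\tilde a^{t}$ is the action profile played $t$ periods after $h$. The profile $\sigma$ is an \emph{$\eta$-uniformly strict perfect public equilibrium} ($\eta$-USPPE) if for every public history $h$, every $i$ and every deviation $(a_i',\rho_i')$ from $\sigma(h)$ that is nontrivial with respect to $m\mapsto w^\sigma(h,m)$, $$g_i(\sigma^a(h))+\tfrac{\delta}{1-\delta}\sum_{m}w_i^\sigma(h,m)\,\tilde p(m\mid\sigma(h))-\eta\ \ge\ g_i(a_i',\sigma^a_{-i}(h))+\tfrac{\delta}{1-\delta}\sum_{m}w_i^\sigma(h,m)\,\tilde p(m\mid(a_i',\rho_i'),\sigma_{-i}(h)).$$ Let $E^\eta(\delta)\subseteq\mathbb R^n$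 be the set of payoff profiles (at the empty history) of all $\eta$-USPPE. \textbf{Bounding set.} For a Euclidean unit vector $\lambda\in\mathbb R^n$ let $k^\eta(\lambda)\in[-\infty,\infty)$ be the value of the program $P^{\lambda,\eta}$: the supremum of $\lambda\cdot v$ over all $v\in\mathbb R^n$, $a\in A$, $\rho\in R$, $x:M\to\mathbb R^n$ such that $v=g(a)+E[x\mid(a,\rho)]$; for every $i$ and every deviation $(a_i',\rho_i')$ from $(a,\rho)$ that is nontrivial with respect to $x$, $g_i(a)+E[x_i\mid(a,\rho)]-\eta\ge g_i(a_i',a_{-i})+E[x_i\mid(a_i',\rho_i'),(a_{-i},\rho_{-i})]$; and $\sum_i\lambda_ix_i(m)\le 0$ for all $m\in M$. Here $k^\eta(\lambda)=-\infty$ if there is no feasible point. Put $Q^\eta=\bigcap_{\|\lambda\|=1}\{y\in\mathbb R^n:\lambda\cdot y\le k^\eta(\lambda)\}$. Call a nonempty compact convex set $W\subseteq\mathbb R^n$ \emph{smooth} if it has a unique supporting hyperplane at every boundary point (precisely: at every boundary point $v$ there is exactly one unit vector $\lambda$ with $\lambda\cdot w\le\lambda\cdot v$ for all $w\in W$). \textbf{Theorem.}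 Suppose that $Q^\eta$ has an interior point in $\mathbb R^n$. Then for every $\varepsilon>0$ there exist a smooth compact convex set $W\subseteq\operatorname{int}Q^\eta$ and $\underline\delta\in(0,1)$ such that $W\subseteq E^\eta(\delta)$ for every $\delta\in(\underline\delta,1)$ and the Hausdorff distance between $W$ and $Q^\eta$ is at most $\varepsilon$. Consequently $Q^\eta$ is the limit $\eta$-USPPE payoff set: the Hausdorff distance between $E^\eta(\delta)$ and $Q^\eta$ tends to $0$ as $\delta\to1$. -/

import Mathlib

open Filter Topology
open scoped BigOperators

/-- Payoff profiles: `ℝⁿ` with the Euclidean inner product and norm. -/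
abbrev Payoff (n : ℕ) : Type := EuclideanSpace ℝ (Fin n)

/-- A stage game with private monitoring: payoffs `g a ∈ ℝⁿ` and, for every action profile `a`,
a probability distribution `p a` on the signal profiles, each player's signal having a marginal
of full support. -/
structure PrivateMonitoringGame (n : ℕ) (A S : Fin n → Type*) [∀ i, Fintype (S i)] where
  g : (∀ i, A i) → Payoff n
  p : (∀ i, A i) → (∀ i, S i) → ℝ
  p_mem : ∀ a, p a ∈ stdSimplex ℝ (∀ i, S i)
  full_support : ∀ (a : ∀ i, A i) (i : Fin n) (si : S i), ∃ s : ∀ j, S j, s i = si ∧ 0 < p a s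

/-- A profile of message strategies `ρ i : S i → M i`. -/
abbrev MessageProfile {n : ℕ} (S M : Fin n → Type*) := ∀ i, S i → M i

/-- A pure public strategy of a player with actions `Ai`, signals `Si`, messages `Mi`, where `Msg`
is the set of message profiles.  A public history is the chronological list of the past message
profiles.  `msg h b` is the message strategy used at the public history `h` after the own
action `b`. -/
structure PublicStrategy (Ai Si Mi Msg : Type*) where
  act : List Msg → Ai
  msg : List Msg → Ai → (Si → Mi)

/-- A profile of pure public strategies. -/
abbrev PublicProfile {n : ℕ} (A S M : Fin n → Type*) :=
  ∀ i, PublicStrategy (A i) (S i) (M i) (∀ j, M j)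

namespace PublicProfile

variable {n : ℕ} {A S M : Fin n → Type*}

/-- The action profile `σᵃ(h)`. -/
def acts (σ : PublicProfile A S M) (h : List (∀ j, M j)) : ∀ i, A i :=
  fun i => (σ i).act h

/-- The on-path message strategies `σᵐ(h, σᵃ(h))`. -/
def msgs (σ : PublicProfile A S M) (h : List (∀ j, M j)) : MessageProfile S M :=
  fun i => (σ i).msg h ((σ i).act h)

end PublicProfile

namespace PrivateMonitoringGame

variable {n : ℕ} {A S M : Fin n → Type*} [∀ i, Fintype (S i)] [∀ i, Fintype (M i)]

open Classical in
/-- The distribution of the public message profile generated by `(a, ρ)`. -/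
noncomputable def msgProb (G : PrivateMonitoringGame n A S) (a : ∀ i, A i)
    (ρ : MessageProfile S M) (m : ∀ i, M i) : ℝ :=
  ∑ s : (∀ i, S i) with (∀ i, ρ i (s i) = m i), G.p a s

/-- The expectation `E[x(·) | (a, ρ)]` of a function of the public message profile. -/
noncomputable def expect (G : PrivateMonitoringGame n A S) (a : ∀ i, A i)
    (ρ : MessageProfile S M) (x : (∀ i, M i) → Payoff n) : Payoff n :=
  ∑ m, G.msgProb a ρ m • x m

open Classical in
/-- The distribution of the random payoff profile `x(m)` when `m` is generated by `(a, ρ)`, as a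
(finitely supported) probability mass function on `ℝⁿ`. -/
noncomputable def payoffLaw (G : PrivateMonitoringGame n A S) (a : ∀ i, A i)
    (ρ : MessageProfile S M) (x : (∀ i, M i) → Payoff n) (y : Payoff n) : ℝ :=
  ∑ m with x m = y, G.msgProb a ρ m

/-- The nontrivial one-shot deviations of player `i` from `(a, ρ)` with respect to `x`: those that
change the own action or the distribution of `x(·)`. -/
def nontrivialDev (G : PrivateMonitoringGame n A S) (a : ∀ i, A i)
    (ρ : MessageProfile S M) (x : (∀ i, M i) → Payoff n) (i : Fin n) :
    Set (A i × (S i → M i)) :=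
  {d | d.1 ≠ a i ∨
    G.payoffLaw (Function.update a i d.1) (Function.update ρ i d.2) x ≠ G.payoffLaw a ρ x}

/-! ### The static programs and the bounding set -/

/-- `(v, a, ρ, x)` is feasible for the program with direction `lam` and strictness `η`. -/
structure Feasible (G : PrivateMonitoringGame n A S) (η : ℝ) (lam : Payoff n)
    (v : Payoff n) (a : ∀ i, A i) (ρ : MessageProfile S M) (x : (∀ i, M i) → Payoff n) :
    Prop where
  value : v = G.g a + G.expect a ρ x
  incentive : ∀ i, ∀ d ∈ G.nontrivialDev a ρ x i,
    G.g a i + G.expect a ρ x i - η ≥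
      G.g (Function.update a i d.1) i +
        G.expect (Function.update a i d.1) (Function.update ρ i d.2) x i
  halfspace : ∀ m, ∑ i, lam i * x m i ≤ 0

variable (M) in
/-- The value of the program: the supremum of `lam ⬝ v` over the feasible points, `-∞` if there
are none. -/
noncomputable def value (G : PrivateMonitoringGame n A S) (η : ℝ) (lam : Payoff n) : EReal :=
  sSup {r : EReal | ∃ (v : Payoff n) (a : ∀ i, A i) (ρ : MessageProfile S M)
    (x : (∀ i, M i) → Payoff n), G.Feasible η lam v a ρ x ∧ r = ((inner ℝ lam v : ℝ) : EReal)}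

variable (M) in
/-- The half-space `{y | lam ⬝ y ≤ k(lam)}`; it is empty if `k(lam) = -∞`. -/
def halfSpace (G : PrivateMonitoringGame n A S) (η : ℝ) (lam : Payoff n) : Set (Payoff n) :=
  {y | ((inner ℝ lam y : ℝ) : EReal) ≤ G.value M η lam}

variable (M) in
/-- The bounding set: the intersection of the half-spaces over all unit directions. -/
def boundingSet (G : PrivateMonitoringGame n A S) (η : ℝ) : Set (Payoff n) :=
  ⋂ lam ∈ Metric.sphere (0 : Payoff n) 1, G.halfSpace M η lam

/-! ### The repeated game -/

/-- The probability that, under `σ`, the public history `h` is followed by the message profiles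
listed in the second argument. -/
noncomputable def pathProb (G : PrivateMonitoringGame n A S) (σ : PublicProfile A S M) :
    List (∀ j, M j) → List (∀ j, M j) → ℝ
  | _, [] => 1
  | h, m :: l => G.msgProb (σ.acts h) (σ.msgs h) m * pathProb G σ (h ++ [m]) l

/-- The expected stage payoff profile `t` periods after the public history `h`. -/
noncomputable def expectedStagePayoff (G : PrivateMonitoringGame n A S)
    (σ : PublicProfile A S M) (h : List (∀ j, M j)) (t : ℕ) : Payoff n :=
  ∑ μ : Fin t → (∀ j, M j),
    G.pathProb σ h (List.ofFn μ) • G.g (σ.acts (h ++ List.ofFn μ))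

/-- The discounted average continuation payoff profile at the public history `h`. -/
noncomputable def contPayoff (G : PrivateMonitoringGame n A S) (δ : ℝ)
    (σ : PublicProfile A S M) (h : List (∀ j, M j)) : Payoff n :=
  (1 - δ) • ∑' t : ℕ, δ ^ t • G.expectedStagePayoff σ h t

/-- `σ` is an `η`-uniformly strict perfect public equilibrium for the discount factor `δ`. -/
def IsUSPPE (G : PrivateMonitoringGame n A S) (η δ : ℝ) (σ : PublicProfile A S M) : Prop :=
  ∀ (h : List (∀ j, M j)) (i : Fin n),
    ∀ d ∈ G.nontrivialDev (σ.acts h) (σ.msgs h) (fun m => G.contPayoff δ σ (h ++ [m])) i,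
      G.g (σ.acts h) i
          + δ / (1 - δ) *
            ∑ m, G.contPayoff δ σ (h ++ [m]) i * G.msgProb (σ.acts h) (σ.msgs h) m - η ≥
        G.g (Function.update (σ.acts h) i d.1) i
          + δ / (1 - δ) *
            ∑ m, G.contPayoff δ σ (h ++ [m]) i *
              G.msgProb (Function.update (σ.acts h) i d.1) (Function.update (σ.msgs h) i d.2) m

variable (M) in
/-- The set of all `η`-USPPE payoff profiles for the discount factor `δ`. -/
def equilibriumPayoffs (G : PrivateMonitoringGame n A S) (η δ : ℝ) : Set (Payoff n) :=
  {v | ∃ σ : PublicProfile A S M, G.IsUSPPE η δ σ ∧ v = G.contPayoff δ σ []}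

end PrivateMonitoringGame

/-- A nonempty compact convex set with a unique supporting hyperplane at every boundary point.
The hyperplane is recorded by its unit normal pointing away from the set, so that in dimension one
a single point does not count as smooth. -/
structure IsSmoothCompactConvex {n : ℕ} (W : Set (Payoff n)) : Prop where
  nonempty : W.Nonempty
  isCompact : IsCompact W
  convex : Convex ℝ W
  unique_normal : ∀ v ∈ frontier W, ∃! lam : Payoff n,
    lam ∈ Metric.sphere (0 : Payoff n) 1 ∧ ∀ w ∈ W, (inner ℝ lam w : ℝ) ≤ inner ℝ lam v

/-! This is a self-generation argument in the normalised continuations x(m) = (δ/(1-δ))(w(h,m) -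
w(h)). In these terms the equilibrium condition at h says that x enforces the play, and the payoff
recursion says w(h) = g + E[x]; neither mentions δ. Translating x affects neither enforcement nor
the nontrivial deviations, so the same η serves the static and the dynamic problem.

Upper bound (`equilibriumPayoffs_subset_boundingSet`): at a history nearly maximising λ·w, a small
translate of x is feasible in direction λ, so k(λ) bounds λ·w.

Lower bound: W is the closed r-neighbourhood of a copy of Q shrunk into its interior. A boundary
point v = k + r u satisfies u·v < k(u), so some feasible point has a value strictly beyond v in
direction u. Translating its x to make the value equal to v gives every x(m) a strictly inward
direction, so small steps land in the ball of radius r about k, inside W. At interior points any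
feasible point will do. Compactness makes the bound on the step (1-δ)/δ uniform
(`exists_uniform_decomposition`), and `subset_equilibriumPayoffs_of_decomposable` builds the
strategies. -/

namespace PrivateMonitoringGame

variable {n : ℕ} {A S M : Fin n → Type*} [∀ i, Fintype (S i)] [∀ i, Fintype (M i)]

/-! ### Static facts -/

lemma msgProb_nonneg (G : PrivateMonitoringGame n A S) (a : ∀ i, A i)
    (ρ : MessageProfile S M) (m : ∀ i, M i) : 0 ≤ G.msgProb a ρ m :=
  Finset.sum_nonneg fun s _ => (G.p_mem a).1 s

lemma sum_msgProb (G : PrivateMonitoringGame n A S) (a : ∀ i, A i) (ρ : MessageProfile S M) :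
    ∑ m, G.msgProb a ρ m = 1 := by
  classical
  have h := Finset.sum_fiberwise (Finset.univ : Finset (∀ i, S i))
    (fun s => (fun i => ρ i (s i) : ∀ i, M i)) (G.p a)
  rw [(G.p_mem a).2] at h
  rw [← h]
  refine Finset.sum_congr rfl fun m _ => ?_
  unfold msgProb
  refine Finset.sum_congr ?_ fun _ _ => rfl
  ext s
  simp [funext_iff]

lemma expect_add_const (G : PrivateMonitoringGame n A S) (a : ∀ i, A i)
    (ρ : MessageProfile S M) (x : (∀ i, M i) → Payoff n) (b : Payoff n) :
    G.expect a ρ (fun m => x m + b) = G.expect a ρ x + b := by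
  unfold expect
  simp only [smul_add, Finset.sum_add_distrib]
  rw [← Finset.sum_smul, sum_msgProb, one_smul]

lemma expect_smul (G : PrivateMonitoringGame n A S) (a : ∀ i, A i)
    (ρ : MessageProfile S M) (x : (∀ i, M i) → Payoff n) (c : ℝ) :
    G.expect a ρ (fun m => c • x m) = c • G.expect a ρ x := by
  unfold expect
  rw [Finset.smul_sum]
  exact Finset.sum_congr rfl fun m _ => smul_comm _ _ _

lemma expect_sub (G : PrivateMonitoringGame n A S) (a : ∀ i, A i)
    (ρ : MessageProfile S M) (x y : (∀ i, M i) → Payoff n) :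
    G.expect a ρ (fun m => x m - y m) = G.expect a ρ x - G.expect a ρ y := by
  unfold expect
  simp only [smul_sub, Finset.sum_sub_distrib]

lemma norm_expect_le (G : PrivateMonitoringGame n A S) (a : ∀ i, A i)
    (ρ : MessageProfile S M) {x : (∀ i, M i) → Payoff n} {C : ℝ} (hx : ∀ m, ‖x m‖ ≤ C) :
    ‖G.expect a ρ x‖ ≤ C := by
  calc ‖G.expect a ρ x‖ ≤ ∑ m, ‖G.msgProb a ρ m • x m‖ := norm_sum_le _ _
    _ ≤ ∑ m, G.msgProb a ρ m * C := by
        refine Finset.sum_le_sum fun m _ => ?_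
        rw [norm_smul, Real.norm_of_nonneg (G.msgProb_nonneg a ρ m)]
        exact mul_le_mul_of_nonneg_left (hx m) (G.msgProb_nonneg a ρ m)
    _ = C := by rw [← Finset.sum_mul, sum_msgProb, one_mul]

lemma inner_expect_le (G : PrivateMonitoringGame n A S) (a : ∀ i, A i)
    (ρ : MessageProfile S M) {x : (∀ i, M i) → Payoff n} {lam : Payoff n} {C : ℝ}
    (hx : ∀ m, inner ℝ lam (x m) ≤ C) : inner ℝ lam (G.expect a ρ x) ≤ C := by
  unfold expect
  rw [inner_sum]
  calc ∑ m, inner ℝ lam (G.msgProb a ρ m • x m) ≤ ∑ m, G.msgProb a ρ m * C := by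
        refine Finset.sum_le_sum fun m _ => ?_
        rw [real_inner_smul_right]
        exact mul_le_mul_of_nonneg_left (hx m) (G.msgProb_nonneg a ρ m)
    _ = C := by rw [← Finset.sum_mul, sum_msgProb, one_mul]

lemma payoffLaw_comp (G : PrivateMonitoringGame n A S) (a : ∀ i, A i) (ρ : MessageProfile S M)
    (x : (∀ i, M i) → Payoff n) {f : Payoff n → Payoff n} (hf : f.Injective) (y : Payoff n) :
    G.payoffLaw a ρ (fun m => f (x m)) (f y) = G.payoffLaw a ρ x y := by
  simp only [payoffLaw, hf.eq_iff]

lemma payoffLaw_eq_zero (G : PrivateMonitoringGame n A S) (a : ∀ i, A i)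
    (ρ : MessageProfile S M) {x : (∀ i, M i) → Payoff n} {y : Payoff n} (hy : ∀ m, x m ≠ y) :
    G.payoffLaw a ρ x y = 0 := by
  simp [payoffLaw, hy]

/-- An injective relabelling of payoff vectors merges no values, so it preserves equality of laws.
It is applied to translations and nonzero scalings, which link w to x. -/
lemma nontrivialDev_comp (G : PrivateMonitoringGame n A S) (a : ∀ i, A i)
    (ρ : MessageProfile S M) (x : (∀ i, M i) → Payoff n) {f : Payoff n → Payoff n}
    (hf : f.Injective) (i : Fin n) :
    G.nontrivialDev a ρ (fun m => f (x m)) i = G.nontrivialDev a ρ x i := by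
  ext d
  simp only [nontrivialDev, Set.mem_ofPred_eq]
  refine or_congr Iff.rfl (not_congr ⟨fun h => ?_, fun h => ?_⟩)
  · ext y
    simpa only [payoffLaw_comp _ _ _ _ hf] using congrFun h (f y)
  · ext z
    -- `f` need not be surjective; off its range both laws vanish.
    by_cases hz : ∃ y, f y = z
    · obtain ⟨y, rfl⟩ := hz
      rw [payoffLaw_comp _ _ _ _ hf, payoffLaw_comp _ _ _ _ hf, h]
    · push Not at hz
      rw [payoffLaw_eq_zero _ _ _ fun m => hz _, payoffLaw_eq_zero _ _ _ fun m => hz _]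

/-- `(a, ρ)` is enforced by `x` with strictness `η`. -/
def Enforces (G : PrivateMonitoringGame n A S) (η : ℝ) (a : ∀ i, A i) (ρ : MessageProfile S M)
    (x : (∀ i, M i) → Payoff n) : Prop :=
  ∀ i, ∀ d ∈ G.nontrivialDev a ρ x i,
    G.g a i + G.expect a ρ x i - η ≥
      G.g (Function.update a i d.1) i +
        G.expect (Function.update a i d.1) (Function.update ρ i d.2) x i

lemma Enforces.add_const {G : PrivateMonitoringGame n A S} {η : ℝ} {a : ∀ i, A i}
    {ρ : MessageProfile S M} {x : (∀ i, M i) → Payoff n} (h : G.Enforces η a ρ x)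
    (b : Payoff n) : G.Enforces η a ρ (fun m => x m + b) := by
  intro i d hd
  rw [nontrivialDev_comp G a ρ x (f := fun y => y + b) (add_left_injective b)] at hd
  have := h i d hd
  rw [expect_add_const, expect_add_const]
  simp only [PiLp.add_apply]
  linarith

lemma inner_eq_sum_mul (lam y : Payoff n) : inner ℝ lam y = ∑ i, lam i * y i := by
  rw [PiLp.inner_apply]
  exact Finset.sum_congr rfl fun i _ => by simp [mul_comm]

lemma Feasible.inner_le {G : PrivateMonitoringGame n A S} {η : ℝ} {lam v : Payoff n}
    {a : ∀ i, A i} {ρ : MessageProfile S M} {x : (∀ i, M i) → Payoff n}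
    (h : G.Feasible η lam v a ρ x) : inner ℝ lam v ≤ inner ℝ lam (G.g a) := by
  have := G.inner_expect_le a ρ (x := x) (lam := lam) (C := 0)
    (fun m => by rw [inner_eq_sum_mul]; exact h.halfspace m)
  rw [h.value, inner_add_right]
  linarith

lemma Feasible.le_value {G : PrivateMonitoringGame n A S} {η : ℝ} {lam v : Payoff n}
    {a : ∀ i, A i} {ρ : MessageProfile S M} {x : (∀ i, M i) → Payoff n}
    (h : G.Feasible η lam v a ρ x) : ((inner ℝ lam v : ℝ) : EReal) ≤ G.value M η lam :=
  le_sSup ⟨v, a, ρ, x, h, rfl⟩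

lemma exists_feasible_of_lt_value {G : PrivateMonitoringGame n A S} {η : ℝ} {lam : Payoff n}
    {r : ℝ} (h : (r : EReal) < G.value M η lam) :
    ∃ (v : Payoff n) (a : ∀ i, A i) (ρ : MessageProfile S M) (x : (∀ i, M i) → Payoff n),
      G.Feasible η lam v a ρ x ∧ r < inner ℝ lam v := by
  obtain ⟨_, ⟨v, a, ρ, x, hF, rfl⟩, hr⟩ := lt_sSup_iff.1 h
  exact ⟨v, a, ρ, x, hF, EReal.coe_lt_coe_iff.1 hr⟩

/-! ### The bounding set -/

lemma exists_norm_g_le [∀ i, Fintype (A i)] (G : PrivateMonitoringGame n A S) :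
    ∃ C : ℝ, 0 ≤ C ∧ ∀ a, ‖G.g a‖ ≤ C := by
  classical
  exact ⟨∑ a, ‖G.g a‖, Finset.sum_nonneg fun _ _ => norm_nonneg _, fun a =>
    Finset.single_le_sum (f := fun a => ‖G.g a‖) (fun _ _ => norm_nonneg _) (Finset.mem_univ a)⟩

lemma value_le {G : PrivateMonitoringGame n A S} {η C : ℝ} (hC : ∀ a, ‖G.g a‖ ≤ C)
    {lam : Payoff n} (hlam : ‖lam‖ = 1) : G.value M η lam ≤ (C : EReal) := by
  refine sSup_le ?_
  rintro _ ⟨v, a, ρ, x, hF, rfl⟩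
  rw [EReal.coe_le_coe_iff]
  calc inner ℝ lam v ≤ inner ℝ lam (G.g a) := hF.inner_le
    _ ≤ ‖lam‖ * ‖G.g a‖ := real_inner_le_norm _ _
    _ ≤ C := by rw [hlam, one_mul]; exact hC a

lemma mem_boundingSet {G : PrivateMonitoringGame n A S} {η : ℝ} {y : Payoff n} :
    y ∈ G.boundingSet M η ↔
      ∀ lam : Payoff n, ‖lam‖ = 1 → ((inner ℝ lam y : ℝ) : EReal) ≤ G.value M η lam := by
  simp [boundingSet, halfSpace]

lemma norm_le_of_mem_boundingSet {G : PrivateMonitoringGame n A S} {η C : ℝ} (hC0 : 0 ≤ C)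
    (hC : ∀ a, ‖G.g a‖ ≤ C) {y : Payoff n} (hy : y ∈ G.boundingSet M η) : ‖y‖ ≤ C := by
  rcases eq_or_ne y 0 with rfl | h0
  · simpa using hC0
  have hn : ‖y‖ ≠ 0 := norm_ne_zero_iff.2 h0
  have h1 : ‖(‖y‖⁻¹ • y)‖ = 1 := by rw [norm_smul, norm_inv, norm_norm, inv_mul_cancel₀ hn]
  have h2 := (mem_boundingSet.1 hy _ h1).trans (value_le hC h1)
  rw [EReal.coe_le_coe_iff, real_inner_smul_left, real_inner_self_eq_norm_sq, sq,
    inv_mul_cancel_left₀ hn] at h2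
  exact h2

lemma isClosed_boundingSet (G : PrivateMonitoringGame n A S) (η : ℝ) :
    IsClosed (G.boundingSet M η) :=
  isClosed_biInter fun _ _ => isClosed_le
    (continuous_coe_real_ereal.comp (continuous_const.inner continuous_id)) continuous_const

lemma convex_boundingSet (G : PrivateMonitoringGame n A S) (η : ℝ) :
    Convex ℝ (G.boundingSet M η) := by
  refine convex_iInter₂ fun lam _ => ?_
  intro y hy z hz s t hs ht hst
  obtain rfl : s = 1 - t := by linarith
  simp only [halfSpace, Set.mem_ofPred_eq] at hy hz ⊢
  -- The bound is an extended real, so the combination is compared with the endpoint of larger inner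
  -- product.
  rcases le_total (inner ℝ lam y) (inner ℝ lam z) with h | h
  · refine le_trans (EReal.coe_le_coe_iff.2 ?_) hz
    rw [inner_add_right, real_inner_smul_right, real_inner_smul_right]
    nlinarith
  · refine le_trans (EReal.coe_le_coe_iff.2 ?_) hy
    rw [inner_add_right, real_inner_smul_right, real_inner_smul_right]
    nlinarith

lemma isCompact_boundingSet [∀ i, Fintype (A i)] (G : PrivateMonitoringGame n A S) (η : ℝ) :
    IsCompact (G.boundingSet M η) := by
  obtain ⟨C, hC0, hC⟩ := G.exists_norm_g_le
  exact Metric.isCompact_of_isClosed_isBounded (G.isClosed_boundingSet η)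
    (isBounded_iff_forall_norm_le.2 ⟨C, fun _ hy => norm_le_of_mem_boundingSet hC0 hC hy⟩)

/-- A small move along `lam` stays in the bounding set. The strictness supplies the inward push at
boundary points of W. -/
lemma inner_lt_value_of_mem_interior {G : PrivateMonitoringGame n A S} {η : ℝ} {v lam : Payoff n}
    (hv : v ∈ interior (G.boundingSet M η)) (hlam : ‖lam‖ = 1) :
    ((inner ℝ lam v : ℝ) : EReal) < G.value M η lam := by
  obtain ⟨e, he, hball⟩ := Metric.mem_nhds_iff.1 (mem_interior_iff_mem_nhds.1 hv)
  have hmem : v + (e / 2) • lam ∈ G.boundingSet M η := by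
    refine hball ?_
    rw [mem_ball_iff_norm, add_sub_cancel_left, norm_smul, hlam, mul_one,
      Real.norm_of_nonneg (by linarith)]
    linarith
  refine lt_of_lt_of_le (EReal.coe_lt_coe_iff.2 ?_) (mem_boundingSet.1 hmem lam hlam)
  rw [inner_add_right, real_inner_smul_right, real_inner_self_eq_norm_sq, hlam]
  linarith

/-! ### Continuation payoffs -/

lemma expectedStagePayoff_zero (G : PrivateMonitoringGame n A S) (σ : PublicProfile A S M)
    (h : List (∀ j, M j)) : G.expectedStagePayoff σ h 0 = G.g (σ.acts h) := by
  simp [expectedStagePayoff, pathProb]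

/-- Condition on the first message profile: a path of length t + 1 is that profile followed by a
path of length t. -/
lemma expectedStagePayoff_succ (G : PrivateMonitoringGame n A S) (σ : PublicProfile A S M)
    (h : List (∀ j, M j)) (t : ℕ) :
    G.expectedStagePayoff σ h (t + 1) =
      G.expect (σ.acts h) (σ.msgs h) fun m => G.expectedStagePayoff σ (h ++ [m]) t := by
  unfold expectedStagePayoff expect
  rw [← Fintype.sum_equiv (Fin.consEquiv fun _ : Fin (t + 1) => (∀ j, M j))
    (fun q => G.pathProb σ h (List.ofFn (Fin.cons q.1 q.2 : Fin (t + 1) → (∀ j, M j))) •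
      G.g (σ.acts (h ++ List.ofFn (Fin.cons q.1 q.2 : Fin (t + 1) → (∀ j, M j))))) _
    (fun q => rfl), Fintype.sum_prod_type]
  refine Finset.sum_congr rfl fun m _ => ?_
  rw [Finset.smul_sum]
  refine Finset.sum_congr rfl fun q _ => ?_
  rw [List.ofFn_cons, pathProb, mul_smul, List.append_assoc, List.singleton_append]

lemma norm_expectedStagePayoff_le {G : PrivateMonitoringGame n A S} {C : ℝ}
    (hC : ∀ a, ‖G.g a‖ ≤ C) (σ : PublicProfile A S M) (h : List (∀ j, M j)) (t : ℕ) :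
    ‖G.expectedStagePayoff σ h t‖ ≤ C := by
  induction t generalizing h with
  | zero => rw [expectedStagePayoff_zero]; exact hC _
  | succ t ih => rw [expectedStagePayoff_succ]; exact G.norm_expect_le _ _ fun m => ih _

lemma summable_expectedStagePayoff {G : PrivateMonitoringGame n A S} {C δ : ℝ}
    (hC : ∀ a, ‖G.g a‖ ≤ C) (hδ : δ ∈ Set.Ioo (0 : ℝ) 1) (σ : PublicProfile A S M)
    (h : List (∀ j, M j)) : Summable fun t : ℕ => δ ^ t • G.expectedStagePayoff σ h t := by
  refine Summable.of_norm_bounded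
    ((summable_geometric_of_lt_one hδ.1.le hδ.2).mul_right C) fun t => ?_
  rw [norm_smul, norm_pow, Real.norm_of_nonneg hδ.1.le]
  exact mul_le_mul_of_nonneg_left (norm_expectedStagePayoff_le hC σ h t) (pow_nonneg hδ.1.le t)

lemma norm_contPayoff_le {G : PrivateMonitoringGame n A S} {C δ : ℝ}
    (hC : ∀ a, ‖G.g a‖ ≤ C) (hδ : δ ∈ Set.Ioo (0 : ℝ) 1) (σ : PublicProfile A S M)
    (h : List (∀ j, M j)) : ‖G.contPayoff δ σ h‖ ≤ C := by
  have h1 : 0 < 1 - δ := sub_pos.2 hδ.2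
  have h2 : ‖∑' t : ℕ, δ ^ t • G.expectedStagePayoff σ h t‖ ≤ (1 - δ)⁻¹ * C :=
    tsum_of_norm_bounded ((hasSum_geometric_of_lt_one hδ.1.le hδ.2).mul_right C) fun t => by
      rw [norm_smul, norm_pow, Real.norm_of_nonneg hδ.1.le]
      exact mul_le_mul_of_nonneg_left (norm_expectedStagePayoff_le hC σ h t)
        (pow_nonneg hδ.1.le t)
  rw [contPayoff, norm_smul, Real.norm_of_nonneg h1.le]
  calc (1 - δ) * _ ≤ (1 - δ) * ((1 - δ)⁻¹ * C) := mul_le_mul_of_nonneg_left h2 h1.le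
    _ = C := mul_inv_cancel_left₀ h1.ne' C

lemma contPayoff_eq [∀ i, Fintype (A i)] (G : PrivateMonitoringGame n A S) {δ : ℝ}
    (hδ : δ ∈ Set.Ioo (0 : ℝ) 1) (σ : PublicProfile A S M) (h : List (∀ j, M j)) :
    G.contPayoff δ σ h = (1 - δ) • G.g (σ.acts h) +
      δ • G.expect (σ.acts h) (σ.msgs h) (fun m => G.contPayoff δ σ (h ++ [m])) := by
  obtain ⟨C, -, hC⟩ := G.exists_norm_g_le
  have hs := summable_expectedStagePayoff hC hδ σ
  have key : ∑' t : ℕ, δ ^ (t + 1) • G.expectedStagePayoff σ h (t + 1) =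
      δ • G.expect (σ.acts h) (σ.msgs h)
        (fun m => ∑' t : ℕ, δ ^ t • G.expectedStagePayoff σ (h ++ [m]) t) := by
    unfold expect
    simp_rw [← (hs _).tsum_const_smul]
    rw [← Summable.tsum_finsetSum fun m _ => (hs _).const_smul _, ← Summable.tsum_const_smul]
    · refine tsum_congr fun t => ?_
      rw [expectedStagePayoff_succ, expect, Finset.smul_sum, Finset.smul_sum]
      refine Finset.sum_congr rfl fun m _ => ?_
      simp only [smul_smul]
      congr 1
      ring
    · exact summable_sum fun m _ => (hs _).const_smul _
  simp only [contPayoff]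
  rw [(hs h).tsum_eq_zero_add, key, expect_smul, pow_zero, one_smul, expectedStagePayoff_zero,
    smul_add, smul_comm]

/-- A bounded solution of the recursion for continuation payoffs is the continuation payoff. -/
lemma eq_contPayoff_of_recursion [∀ i, Fintype (A i)] (G : PrivateMonitoringGame n A S) {δ : ℝ}
    (hδ : δ ∈ Set.Ioo (0 : ℝ) 1) (σ : PublicProfile A S M) {f : List (∀ j, M j) → Payoff n}
    {D : ℝ} (hD : ∀ h, ‖f h‖ ≤ D)
    (hf : ∀ h, f h = (1 - δ) • G.g (σ.acts h) +
      δ • G.expect (σ.acts h) (σ.msgs h) (fun m => f (h ++ [m]))) (h : List (∀ j, M j)) :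
    f h = G.contPayoff δ σ h := by
  obtain ⟨C, -, hC⟩ := G.exists_norm_g_le
  -- Each unrolling of the two recursions contracts their difference by a factor δ.
  have key : ∀ (k : ℕ) (h : List (∀ j, M j)),
      ‖f h - G.contPayoff δ σ h‖ ≤ δ ^ k * (D + C) := by
    intro k
    induction k with
    | zero =>
      intro h
      rw [pow_zero, one_mul]
      exact (norm_sub_le _ _).trans (add_le_add (hD h) (norm_contPayoff_le hC hδ σ h))
    | succ k ih =>
      intro h
      rw [hf h, G.contPayoff_eq hδ σ h, add_sub_add_left_eq_sub, ← smul_sub, ← expect_sub,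
        norm_smul, Real.norm_of_nonneg hδ.1.le, pow_succ', mul_assoc]
      exact mul_le_mul_of_nonneg_left (G.norm_expect_le _ _ fun m => ih _) hδ.1.le
  have hlim : Tendsto (fun k : ℕ => δ ^ k * (D + C)) atTop (𝓝 0) := by
    simpa using (tendsto_pow_atTop_nhds_zero_of_lt_one hδ.1.le hδ.2).mul_const (D + C)
  exact sub_eq_zero.1 (norm_le_zero_iff.1 (ge_of_tendsto' hlim fun k => key k h))

/-- The equilibrium condition says that the normalised continuation payoffs enforce the play. -/
lemma isUSPPE_iff_enforces (G : PrivateMonitoringGame n A S) {η δ : ℝ}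
    (hδ : δ ∈ Set.Ioo (0 : ℝ) 1) (σ : PublicProfile A S M) :
    G.IsUSPPE η δ σ ↔ ∀ h, G.Enforces η (σ.acts h) (σ.msgs h)
      (fun m => (δ / (1 - δ)) • G.contPayoff δ σ (h ++ [m])) := by
  have hc : δ / (1 - δ) ≠ 0 := (div_pos hδ.1 (sub_pos.2 hδ.2)).ne'
  have hexp : ∀ (a : ∀ i, A i) (ρ : MessageProfile S M) (w : (∀ i, M i) → Payoff n) (i : Fin n),
      G.expect a ρ (fun m => (δ / (1 - δ)) • w m) i =
        δ / (1 - δ) * ∑ m, w m i * G.msgProb a ρ m := by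
    intro a ρ w i
    rw [expect_smul, PiLp.smul_apply, smul_eq_mul, expect]
    simp [mul_comm]
  unfold IsUSPPE Enforces
  refine forall_congr' fun h => forall_congr' fun i => forall_congr' fun d => ?_
  rw [nontrivialDev_comp G _ _ (fun m => G.contPayoff δ σ (h ++ [m]))
    (f := fun y => (δ / (1 - δ)) • y) (smul_right_injective _ hc), hexp, hexp]

/-- If k(λ) < r < λ·w at the empty history, let s be the supremum of λ·w over all histories. It need
not be attained, so the gap s - r is split: (1-δ)(s-r) for the choice of h and δ(s-r) for a
translation along -λ. -/
theorem equilibriumPayoffs_subset_boundingSet [∀ i, Fintype (A i)]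
    (G : PrivateMonitoringGame n A S) {η δ : ℝ} (hδ : δ ∈ Set.Ioo (0 : ℝ) 1) :
    G.equilibriumPayoffs M η δ ⊆ G.boundingSet M η := by
  rintro _ ⟨σ, hσ, rfl⟩
  rw [isUSPPE_iff_enforces G hδ] at hσ
  rw [mem_boundingSet]
  intro lam hlam
  by_contra! hlt
  obtain ⟨r, hr, hr'⟩ := EReal.lt_iff_exists_real_btwn.1 hlt
  rw [EReal.coe_lt_coe_iff] at hr'
  obtain ⟨C, -, hC⟩ := G.exists_norm_g_le
  have hbdd : BddAbove (Set.range fun h => inner ℝ lam (G.contPayoff δ σ h)) := by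
    refine ⟨C, ?_⟩
    rintro _ ⟨h, rfl⟩
    calc inner ℝ lam (G.contPayoff δ σ h) ≤ ‖lam‖ * ‖G.contPayoff δ σ h‖ := real_inner_le_norm _ _
      _ ≤ C := by rw [hlam, one_mul]; exact norm_contPayoff_le hC hδ σ h
  set s := ⨆ h, inner ℝ lam (G.contPayoff δ σ h) with hs
  have hle : ∀ h, inner ℝ lam (G.contPayoff δ σ h) ≤ s := fun h => le_ciSup hbdd h
  have h1 : 0 < 1 - δ := sub_pos.2 hδ.2
  have he : 0 < s - r := by linarith [hle []]
  obtain ⟨h, hh⟩ := exists_lt_of_lt_ciSup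
    (show s - (1 - δ) * (s - r) < ⨆ h, inner ℝ lam (G.contPayoff δ σ h) from
      sub_lt_self _ (mul_pos h1 he))
  -- Continuations exceed w(h) in direction λ by less than (1-δ)(s-r); after scaling by δ/(1-δ), the
  -- shift δ(s-r) absorbs this. The score stays above s - (1-δ)(s-r) - δ(s-r) = r.
  have hF : G.Feasible η lam (G.contPayoff δ σ h - (δ * (s - r)) • lam) (σ.acts h) (σ.msgs h)
      (fun m => (δ / (1 - δ)) • G.contPayoff δ σ (h ++ [m]) +
        (-(δ / (1 - δ)) • G.contPayoff δ σ h - (δ * (s - r)) • lam)) := by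
    refine ⟨?_, (hσ h).add_const _, fun m => ?_⟩
    · rw [expect_add_const, expect_smul, ← add_sub_assoc, ← add_sub_assoc]
      congr 1
      have hrec := G.contPayoff_eq hδ σ h
      have hg : G.g (σ.acts h) = (1 - δ)⁻¹ • (G.contPayoff δ σ h -
          δ • G.expect (σ.acts h) (σ.msgs h) (fun m => G.contPayoff δ σ (h ++ [m]))) := by
        rw [eq_inv_smul_iff₀ h1.ne', eq_sub_iff_add_eq]
        exact hrec.symm
      rw [hg]
      match_scalars <;> field_simp <;> ring
    · rw [← inner_eq_sum_mul, inner_add_right, inner_sub_right, real_inner_smul_right,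
        real_inner_smul_right, real_inner_smul_right, real_inner_self_eq_norm_sq, hlam]
      have h2 : δ / (1 - δ) * (inner ℝ lam (G.contPayoff δ σ (h ++ [m])) -
          inner ℝ lam (G.contPayoff δ σ h)) ≤ δ / (1 - δ) * ((1 - δ) * (s - r)) :=
        mul_le_mul_of_nonneg_left (by linarith [hle (h ++ [m])]) (div_pos hδ.1 h1).le
      have h3 : δ / (1 - δ) * ((1 - δ) * (s - r)) = δ * (s - r) := by field_simp
      linarith
  have hval := lt_of_le_of_lt hF.le_value hr
  rw [EReal.coe_lt_coe_iff, inner_sub_right, real_inner_smul_right, real_inner_self_eq_norm_sq,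
    hlam] at hval
  linarith

/-- A bounded set all of whose points are decomposable on the set itself consists of equilibrium
payoffs. -/
theorem subset_equilibriumPayoffs_of_decomposable [∀ i, Fintype (A i)]
    (G : PrivateMonitoringGame n A S) {η δ D : ℝ} (hδ : δ ∈ Set.Ioo (0 : ℝ) 1)
    {W : Set (Payoff n)} (hD : ∀ v ∈ W, ‖v‖ ≤ D)
    (hW : ∀ v ∈ W, ∃ (a : ∀ i, A i) (ρ : MessageProfile S M) (x : (∀ i, M i) → Payoff n),
      G.Enforces η a ρ x ∧ v = G.g a + G.expect a ρ x ∧ ∀ m, v + ((1 - δ) / δ) • x m ∈ W) :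
    W ⊆ G.equilibriumPayoffs M η δ := by
  intro v₀ hv₀
  have hW' : ∀ v : W, ∃ (a : ∀ i, A i) (ρ : MessageProfile S M) (x : (∀ i, M i) → Payoff n),
      G.Enforces η a ρ x ∧ (v : Payoff n) = G.g a + G.expect a ρ x ∧
        ∀ m, (v : Payoff n) + ((1 - δ) / δ) • x m ∈ W := fun v => hW v v.2
  choose a ρ x hinc hval hnext using hW'
  -- The public state is the promised payoff, updated by each message profile. Message strategies
  -- may ignore the own action, since the equilibrium condition only sees them after the prescribed
  -- one.
  let next : W → (∀ i, M i) → W := fun v m => ⟨_, hnext v m⟩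
  let state : List (∀ i, M i) → W := fun h => h.foldl next ⟨v₀, hv₀⟩
  let σ : PublicProfile A S M := fun i =>
    { act := fun h => a (state h) i, msg := fun h _ => ρ (state h) i }
  have hacts : ∀ h, σ.acts h = a (state h) := fun h => rfl
  have hmsgs : ∀ h, σ.msgs h = ρ (state h) := fun h => rfl
  have hstate : ∀ h m, (state (h ++ [m]) : Payoff n) =
      ((1 - δ) / δ) • x (state h) m + (state h : Payoff n) := by
    intro h m
    simp only [state, List.foldl_append, List.foldl_cons, List.foldl_nil]
    exact add_comm _ _
  have hδ0 : δ ≠ 0 := hδ.1.ne'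
  have h1 : 1 - δ ≠ 0 := (sub_pos.2 hδ.2).ne'
  have hcont : ∀ h, (state h : Payoff n) = G.contPayoff δ σ h := by
    refine G.eq_contPayoff_of_recursion hδ σ (fun h => hD _ (state h).2) fun h => ?_
    simp only [hstate]
    rw [expect_add_const, expect_smul, hacts, hmsgs]
    conv_lhs => rw [hval (state h)]
    conv_rhs => rw [hval (state h)]
    match_scalars <;> field_simp <;> ring
  refine ⟨σ, (isUSPPE_iff_enforces G hδ σ).2 fun h => ?_, hcont []⟩
  have := (hinc (state h)).add_const ((δ / (1 - δ)) • (state h : Payoff n))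
  rw [hacts, hmsgs]
  convert this using 2 with m
  rw [← hcont, hstate]
  match_scalars <;> field_simp

end PrivateMonitoringGame

/-! ### Convex geometry -/

section Geometry

variable {n : ℕ}

/-- A noninterior point of the closed `r`-neighbourhood of a compact convex set lies at distance
exactly `r`, along a normal vector of the set, from some point of the set. -/
lemma exists_normal_of_mem_cthickening {K : Set (Payoff n)} (hK : IsCompact K)
    (hKc : Convex ℝ K) {r : ℝ} (hr : 0 < r) {v : Payoff n} (hv : v ∈ Metric.cthickening r K)
    (hv' : v ∉ interior (Metric.cthickening r K)) :
    ∃ u : Payoff n, ‖u‖ = 1 ∧ ∃ k ∈ K, v = k + r • u ∧ ∀ w ∈ K, inner ℝ u w ≤ inner ℝ u k := by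
  have hv₁ := hv
  rw [hK.cthickening_eq_biUnion_closedBall hr.le, Set.mem_iUnion₂] at hv₁
  obtain ⟨k₁, hk₁, hvk₁⟩ := hv₁
  obtain ⟨k, hk, hmin⟩ := exists_norm_eq_iInf_of_complete_convex ⟨k₁, hk₁⟩ hK.isComplete hKc v
  have hinner := (norm_eq_iInf_iff_real_inner_le_zero hKc hk).1 hmin
  have hle : ‖v - k‖ ≤ r := by
    rw [hmin]
    have hb : BddBelow (Set.range fun w : K => ‖v - w‖) :=
      ⟨0, by rintro _ ⟨w, rfl⟩; exact norm_nonneg _⟩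
    exact (ciInf_le hb ⟨k₁, hk₁⟩).trans (by rwa [mem_closedBall_iff_norm] at hvk₁)
  have hge : r ≤ ‖v - k‖ := by
    by_contra! hlt
    refine hv' (interior_maximal ?_ Metric.isOpen_ball (mem_ball_iff_norm.2 hlt))
    exact Metric.ball_subset_closedBall.trans (Metric.closedBall_subset_cthickening hk r)
  refine ⟨r⁻¹ • (v - k), ?_, k, hk, ?_, fun w hw => ?_⟩
  · rw [norm_smul, norm_inv, Real.norm_of_nonneg hr.le, le_antisymm hle hge,
      inv_mul_cancel₀ hr.ne']
  · rw [smul_inv_smul₀ hr.ne', add_sub_cancel]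
  · rw [← sub_nonpos, ← inner_sub_right, real_inner_smul_left]
    exact mul_nonpos_of_nonneg_of_nonpos (inv_nonneg.2 hr.le) (hinner w hw)

/-- At v = k + r u, a unit normal l must satisfy l·(k + r l) ≤ l·(k + r u), because the ball about k
lies in the set. Hence l·u ≥ 1, which forces l = u. -/
lemma isSmoothCompactConvex_cthickening {K : Set (Payoff n)} (hK : IsCompact K)
    (hKc : Convex ℝ K) (hKne : K.Nonempty) {r : ℝ} (hr : 0 < r) :
    IsSmoothCompactConvex (Metric.cthickening r K) := by
  refine ⟨hKne.mono (Metric.self_subset_cthickening K), hK.cthickening, hKc.cthickening r, ?_⟩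
  intro v hv
  obtain ⟨u, hu, k, hk, rfl, hnormal⟩ := exists_normal_of_mem_cthickening hK hKc hr
    (Metric.isClosed_cthickening.frontier_subset hv) hv.2
  refine ⟨u, ⟨mem_sphere_zero_iff_norm.2 hu, fun w hw => ?_⟩, ?_⟩
  · rw [hK.cthickening_eq_biUnion_closedBall hr.le, Set.mem_iUnion₂] at hw
    obtain ⟨k', hk', hwk'⟩ := hw
    rw [mem_closedBall_iff_norm] at hwk'
    have h1 : inner ℝ u (w - k') ≤ r :=
      (real_inner_le_norm _ _).trans (by rw [hu, one_mul]; exact hwk')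
    rw [inner_sub_right] at h1
    rw [inner_add_right, real_inner_smul_right, real_inner_self_eq_norm_sq, hu]
    linarith [hnormal k' hk']
  · rintro l ⟨hl, hmax⟩
    rw [mem_sphere_zero_iff_norm] at hl
    have hmem : k + r • l ∈ Metric.cthickening r K := by
      refine Metric.closedBall_subset_cthickening hk r ?_
      rw [mem_closedBall_iff_norm, add_sub_cancel_left, norm_smul, hl, mul_one,
        Real.norm_of_nonneg hr.le]
    have h1 := hmax _ hmem
    rw [inner_add_right, inner_add_right, real_inner_smul_right, real_inner_smul_right,
      real_inner_self_eq_norm_sq, hl] at h1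
    have h2 : 1 ≤ inner ℝ l u := by nlinarith
    have h3 : inner ℝ l u ≤ 1 := (real_inner_le_norm _ _).trans (by rw [hl, hu, one_mul])
    exact (inner_eq_one_iff_of_norm_eq_one hl hu).1 (le_antisymm h3 h2)

/-- The squared distance to k is r² + τ(2r u·d + τ‖d‖²), and the bracket is negative for small τ. -/
lemma eventually_add_smul_mem_ball {k u d : Payoff n} {r : ℝ} (hr : 0 < r) (hu : ‖u‖ = 1)
    (hd : inner ℝ u d < 0) : ∀ᶠ τ : ℝ in 𝓝[>] 0, k + r • u + τ • d ∈ Metric.ball k r := by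
  have hcont : Continuous fun τ : ℝ => 2 * r * inner ℝ u d + τ * ‖d‖ ^ 2 := by fun_prop
  have hneg : ∀ᶠ τ : ℝ in 𝓝 0, 2 * r * inner ℝ u d + τ * ‖d‖ ^ 2 < 0 :=
    hcont.continuousAt.eventually_lt_const (by
      simp only [zero_mul, add_zero]
      exact mul_neg_of_pos_of_neg (by linarith) hd)
  filter_upwards [nhdsWithin_le_nhds hneg, self_mem_nhdsWithin] with τ h1 (h2 : 0 < τ)
  rw [mem_ball_iff_norm, add_assoc, add_sub_cancel_left]
  refine lt_of_pow_lt_pow_left₀ 2 hr.le ?_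
  rw [norm_add_sq_real, norm_smul, norm_smul, hu, real_inner_smul_left, real_inner_smul_right,
    mul_one, Real.norm_of_nonneg hr.le, Real.norm_of_nonneg h2.le]
  nlinarith [mul_neg_of_pos_of_neg h2 h1]

/-- A compact convex set is approximated by neighbourhoods of compact convex sets in its
interior. -/
lemma exists_cthickening_subset_interior {Q : Set (Payoff n)} (hQ : IsCompact Q)
    (hQc : Convex ℝ Q) (hQi : (interior Q).Nonempty) {ε : ℝ} (hε : 0 < ε) :
    ∃ K : Set (Payoff n), IsCompact K ∧ Convex ℝ K ∧ K.Nonempty ∧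
      (∀ q ∈ Q, ∃ k ∈ K, dist q k ≤ ε) ∧
      ∃ r : ℝ, 0 < r ∧ Metric.cthickening r K ⊆ interior Q := by
  obtain ⟨q₀, hq₀⟩ := hQi
  obtain ⟨D, hD0, hD⟩ : ∃ D : ℝ, 0 ≤ D ∧ ∀ q ∈ Q, ‖q₀ - q‖ ≤ D := by
    obtain ⟨C, hC⟩ := hQ.isBounded.exists_norm_le
    refine ⟨‖q₀‖ + C, ?_, fun q hq => (norm_sub_le _ _).trans (by linarith [hC q hq])⟩
    linarith [norm_nonneg q₀, hC q₀ (interior_subset hq₀)]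
  -- The homothety towards `q₀` with this ratio moves points by at most tD ≤ ε, and t ≤ 1 even when
  -- D = 0.
  set t := ε / (ε + D) with ht
  have ht0 : 0 < t := div_pos hε (by linarith)
  have ht1 : t ≤ 1 := (div_le_one (by linarith)).2 (by linarith)
  have htD : t * D ≤ ε := by
    rw [ht, div_mul_eq_mul_div, div_le_iff₀ (by linarith)]
    nlinarith
  set K := (fun q : Payoff n => q + t • (q₀ - q)) '' Q with hKdef
  have hK : IsCompact K := hQ.image (by fun_prop)
  have hKQ : K ⊆ interior Q := by
    rintro _ ⟨q, hq, rfl⟩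
    exact hQc.add_smul_sub_mem_interior hq hq₀ ⟨ht0, ht1⟩
  have hKc : Convex ℝ K := by
    rintro _ ⟨y, hy, rfl⟩ _ ⟨z, hz, rfl⟩ b c hb hc hbc
    refine ⟨b • y + c • z, hQc hy hz hb hc hbc, ?_⟩
    obtain rfl : b = 1 - c := by linarith
    module
  obtain ⟨r, hr, hrK⟩ := hK.exists_cthickening_subset_open isOpen_interior hKQ
  refine ⟨K, hK, hKc, ⟨_, q₀, interior_subset hq₀, rfl⟩, fun q hq => ⟨_, ⟨q, hq, rfl⟩, ?_⟩,
    r, hr, hrK⟩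
  rw [dist_comm, dist_eq_norm, add_sub_cancel_left, norm_smul, Real.norm_of_nonneg ht0.le]
  exact (mul_le_mul_of_nonneg_left (hD q hq) ht0.le).trans htD

end Geometry

/-! ### Decomposability on smooth sets inside the bounding set -/

namespace PrivateMonitoringGame

variable {n : ℕ} {A S M : Fin n → Type*} [∀ i, Fintype (S i)] [∀ i, Fintype (M i)]

/-- Dimension zero is separate: there are no unit vectors, but every condition of the program holds
trivially. -/
lemma exists_feasible_of_mem_interior {G : PrivateMonitoringGame n A S} {η : ℝ} {v : Payoff n}
    (hv : v ∈ interior (G.boundingSet M η)) :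
    ∃ (lam v : Payoff n) (a : ∀ i, A i) (ρ : MessageProfile S M) (x : (∀ i, M i) → Payoff n),
      G.Feasible η lam v a ρ x := by
  rcases n with _ | n
  · exact ⟨0, 0, fun i => i.elim0, fun i => i.elim0, 0, Subsingleton.elim _ _,
      fun i => i.elim0, fun m => by simp⟩
  · obtain ⟨w, a, ρ, x, hF, -⟩ := exists_feasible_of_lt_value
      (inner_lt_value_of_mem_interior hv (lam := EuclideanSpace.single 0 1) (by simp))
    exact ⟨_, w, a, ρ, x, hF⟩

/-- Every point of a neighbourhood `W` of a compact convex set, with `W` in the interior of the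
bounding set, is decomposable on the interior of `W` if the future has a large enough weight. -/
lemma exists_enforces_of_mem_cthickening (G : PrivateMonitoringGame n A S) {η r : ℝ}
    {K : Set (Payoff n)} (hK : IsCompact K) (hKc : Convex ℝ K) (hr : 0 < r)
    (hKQ : Metric.cthickening r K ⊆ interior (G.boundingSet M η)) {v : Payoff n}
    (hv : v ∈ Metric.cthickening r K) :
    ∃ (a : ∀ i, A i) (ρ : MessageProfile S M) (x : (∀ i, M i) → Payoff n),
      G.Enforces η a ρ x ∧ ∃ τ : ℝ, 0 < τ ∧
        ∀ m, v + τ • (x m + (v - (G.g a + G.expect a ρ x))) ∈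
          interior (Metric.cthickening r K) := by
  by_cases hint : v ∈ interior (Metric.cthickening r K)
  · obtain ⟨lam, w, a, ρ, x, hF⟩ := exists_feasible_of_mem_interior (hKQ hv)
    refine ⟨a, ρ, x, hF.incentive, ?_⟩
    have hev : ∀ᶠ τ : ℝ in 𝓝[>] 0, ∀ m, v + τ • (x m + (v - (G.g a + G.expect a ρ x))) ∈
        interior (Metric.cthickening r K) := by
      refine nhdsWithin_le_nhds (eventually_all.2 fun m => ?_)
      have hcont : Continuous fun τ : ℝ => v + τ • (x m + (v - (G.g a + G.expect a ρ x))) := by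
        fun_prop
      exact hcont.continuousAt.eventually_mem (isOpen_interior.mem_nhds (by simpa using hint))
    obtain ⟨τ, hτ, hτ0⟩ := (hev.and self_mem_nhdsWithin).exists
    exact ⟨τ, hτ0, hτ⟩
  · obtain ⟨u, hu, k, hk, hvk, -⟩ := exists_normal_of_mem_cthickening hK hKc hr hv hint
    obtain ⟨w, a, ρ, x, hF, hlt⟩ := exists_feasible_of_lt_value
      (inner_lt_value_of_mem_interior (hKQ hv) hu)
    refine ⟨a, ρ, x, hF.incentive, ?_⟩
    -- The translated x(m) has inner product at most u·v - u·w < 0 with u; finiteness of M allows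
    -- one τ for all m.
    have hev : ∀ᶠ τ : ℝ in 𝓝[>] 0, ∀ m, v + τ • (x m + (v - (G.g a + G.expect a ρ x))) ∈
        Metric.ball k r := by
      refine eventually_all.2 fun m => ?_
      rw [hvk]
      refine eventually_add_smul_mem_ball hr hu ?_
      have := hF.halfspace m
      rw [← hvk, ← hF.value, inner_add_right, inner_sub_right, inner_eq_sum_mul u (x m)]
      linarith
    obtain ⟨τ, hτ, hτ0⟩ := (hev.and self_mem_nhdsWithin).exists
    refine ⟨τ, hτ0, fun m => interior_maximal ?_ Metric.isOpen_ball (hτ m)⟩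
    exact Metric.ball_subset_closedBall.trans (Metric.closedBall_subset_cthickening hk r)

/-- The step τ stands for (1-δ)/δ. The play and x found at v serve all nearby w in W after a
translation depending on w, since the targets lie in an open set; compactness then leaves finitely
many step bounds. -/
lemma exists_uniform_decomposition (G : PrivateMonitoringGame n A S) {η r : ℝ}
    {K : Set (Payoff n)} (hK : IsCompact K) (hKc : Convex ℝ K) (hr : 0 < r)
    (hKQ : Metric.cthickening r K ⊆ interior (G.boundingSet M η)) :
    ∃ τ₀ : ℝ, 0 < τ₀ ∧ ∀ τ ∈ Set.Ioc 0 τ₀, ∀ v ∈ Metric.cthickening r K,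
      ∃ (a : ∀ i, A i) (ρ : MessageProfile S M) (x : (∀ i, M i) → Payoff n),
        G.Enforces η a ρ x ∧ v = G.g a + G.expect a ρ x ∧
          ∀ m, v + τ • x m ∈ Metric.cthickening r K := by
  set W := Metric.cthickening r K with hW
  refine IsCompact.induction_on (s := W) hK.cthickening
    (p := fun s => ∃ τ₀ : ℝ, 0 < τ₀ ∧ ∀ τ ∈ Set.Ioc 0 τ₀, ∀ v ∈ s,
      ∃ (a : ∀ i, A i) (ρ : MessageProfile S M) (x : (∀ i, M i) → Payoff n),
        G.Enforces η a ρ x ∧ v = G.g a + G.expect a ρ x ∧ ∀ m, v + τ • x m ∈ W)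
    ⟨1, one_pos, fun _ _ _ hv => hv.elim⟩ ?_ ?_ ?_
  · rintro s t hst ⟨τ₀, h0, h⟩
    exact ⟨τ₀, h0, fun τ hτ v hv => h τ hτ v (hst hv)⟩
  · rintro s t ⟨τ₁, h1, hs⟩ ⟨τ₂, h2, ht⟩
    refine ⟨min τ₁ τ₂, lt_min h1 h2, fun τ hτ v hv => ?_⟩
    rcases hv with hv | hv
    · exact hs τ ⟨hτ.1, hτ.2.trans (min_le_left _ _)⟩ v hv
    · exact ht τ ⟨hτ.1, hτ.2.trans (min_le_right _ _)⟩ v hv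
  · intro v hv
    obtain ⟨a, ρ, x, hinc, τ₀, h0, hmem⟩ := G.exists_enforces_of_mem_cthickening hK hKc hr hKQ hv
    refine ⟨W ∩ {w | ∀ m, w + τ₀ • (x m + (w - (G.g a + G.expect a ρ x))) ∈ interior W},
      inter_mem self_mem_nhdsWithin (nhdsWithin_le_nhds (eventually_all.2 fun m => ?_)),
      τ₀, h0, ?_⟩
    · have hcont : Continuous fun w => w + τ₀ • (x m + (w - (G.g a + G.expect a ρ x))) := by
        fun_prop
      exact hcont.continuousAt.eventually_mem (isOpen_interior.mem_nhds (hmem m))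
    · rintro τ ⟨hτ, hτ'⟩ w ⟨hw, hw'⟩
      refine ⟨a, ρ, _, hinc.add_const (w - (G.g a + G.expect a ρ x)), ?_, fun m => ?_⟩
      · rw [expect_add_const]
        abel
      -- A shorter step ends on the segment from w to the end of the τ₀-step, so convexity covers
      -- all τ ≤ τ₀.
      · have := (hKc.cthickening r).add_smul_mem hw (interior_subset (hw' m))
          (t := τ / τ₀) ⟨(div_pos hτ h0).le, (div_le_one h0).2 hτ'⟩
        rwa [smul_smul, div_mul_cancel₀ _ h0.ne'] at this

end PrivateMonitoringGame

theorem mainTheorem1 {n : ℕ} {A S M : Fin n → Type*}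
    [∀ i, Fintype (A i)] [∀ i, Fintype (S i)] [∀ i, Fintype (M i)]
    (G : PrivateMonitoringGame n A S) (η : ℝ) (hη : 0 ≤ η)
    (hQ : (interior (G.boundingSet M η)).Nonempty) :
    (∀ ε : ℝ, 0 < ε →
      ∃ W : Set (Payoff n), IsSmoothCompactConvex W ∧ W ⊆ interior (G.boundingSet M η) ∧
        Metric.hausdorffEDist W (G.boundingSet M η) ≤ ENNReal.ofReal ε ∧
        ∃ δ₀ ∈ Set.Ioo (0 : ℝ) 1, ∀ δ ∈ Set.Ioo δ₀ 1, W ⊆ G.equilibriumPayoffs M η δ) ∧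
    Tendsto (fun δ : ℝ => Metric.hausdorffEDist (G.equilibriumPayoffs M η δ) (G.boundingSet M η))
      (𝓝[<] 1) (𝓝 0) := by
  -- The limit follows from the approximation claim, as W ⊆ E(δ) ⊆ Q for δ near 1.
  refine (and_iff_left_of_imp fun hfirst => ?_).2 fun ε hε => ?_
  · rw [ENNReal.tendsto_nhds_zero]
    intro ε hε
    obtain ⟨e, he, heε⟩ := ENNReal.lt_iff_exists_nnreal_btwn.1 hε
    obtain ⟨W, -, -, hdist, δ₀, hδ₀, hsub⟩ := hfirst e (by simpa using he)
    rw [ENNReal.ofReal_coe_nnreal] at hdist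
    filter_upwards [Ioo_mem_nhdsLT hδ₀.2] with δ hδ
    refine Metric.hausdorffEDist_le_of_infEDist (fun y hy => ?_) fun q hq => ?_
    · rw [Metric.infEDist_zero_of_mem
        (G.equilibriumPayoffs_subset_boundingSet ⟨hδ₀.1.trans hδ.1, hδ.2⟩ hy)]
      exact zero_le
    · calc Metric.infEDist q (G.equilibriumPayoffs M η δ) ≤ Metric.infEDist q W :=
            Metric.infEDist_anti (hsub δ hδ)
        _ ≤ Metric.hausdorffEDist (G.boundingSet M η) W :=
            Metric.infEDist_le_hausdorffEDist_of_mem hq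
        _ ≤ ε := by rw [Metric.hausdorffEDist_comm]; exact hdist.trans heε.le
  · obtain ⟨K, hK, hKc, hKne, happrox, r, hr, hKQ⟩ := exists_cthickening_subset_interior
      (G.isCompact_boundingSet η) (G.convex_boundingSet η) hQ hε
    obtain ⟨τ₀, hτ₀, hdec⟩ := G.exists_uniform_decomposition hK hKc hr hKQ
    obtain ⟨D, hD⟩ := (hK.cthickening (r := r)).isBounded.exists_norm_le
    -- For positive δ, the bound δ > (1 + τ₀)⁻¹ is the same as (1-δ)/δ < τ₀.
    refine ⟨Metric.cthickening r K, isSmoothCompactConvex_cthickening hK hKc hKne hr, hKQ, ?_,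
      (1 + τ₀)⁻¹, ⟨by positivity, inv_lt_one_of_one_lt₀ (by linarith)⟩, fun δ hδ => ?_⟩
    · refine Metric.hausdorffEDist_le_of_mem_edist
        (fun w hw => ⟨w, interior_subset (hKQ hw), by simp⟩) fun q hq => ?_
      obtain ⟨k, hk, hdist⟩ := happrox q hq
      exact ⟨k, Metric.self_subset_cthickening K hk, by
        rw [edist_dist]; exact ENNReal.ofReal_le_ofReal hdist⟩
    · have hδ0 : 0 < δ := lt_trans (by positivity) hδ.1
      refine G.subset_equilibriumPayoffs_of_decomposable ⟨hδ0, hδ.2⟩ hD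
        (hdec _ ⟨div_pos (sub_pos.2 hδ.2) hδ0, ?_⟩)
      have h1 := (inv_lt_iff_one_lt_mul₀ (by linarith)).1 hδ.1
      rw [div_le_iff₀ hδ0]
      linarith
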